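/- Let $(\Omega,\mathcal F,P)$ be a complete probability space with a filtration $(\mathcal F_t)_{t\ge 0}$ satisfying the usual conditions, let $n\ge 0$ be an integer and $r>0$, and let $$D_r=\Big\{\varphi:(-\infty,0]\to\mathbb R^n \text{ càdlàg} : \lim_{\theta\to-\infty}e^{r\theta}\varphi(\theta)\text{ exists in }\mathbb R^n\Big\},\qquad \|\varphi\|_r=\sup_{\theta\le 0}e^{r\theta}|\varphi(\theta)|.$$ Let $\nu$ be a $\sigma$-finite measure on $\mathbb R^n$ with $\nu(\{0\})=0$ and $\int(|z|^2\wedge 1)\,\nu(dz)<\infty$, let $N$ be a time-homogeneous $(\mathcal F_t)$-Poisson random measure with intensity $\nu(dz)\,dt$, let $\tilde N(dz,dt)=N(dz,dt)-\nu(dz)\,dt$, and let $$L(t)=\int_0^t\!\!\int_{0<|z|\le 1}z\,\tilde N(dz,ds)+\int_0^t\!\!\int_{|z|>1}z\,N(dz,ds).$$ Let $f:D_r\to\mathbb R^n$ be Borel measurable. For a path $x$ write $x_t=\{x(t+\theta):\theta\le 0\}$, and for $\xi\in D_r$ consider the equations $$\text{(1)}\ \ dx(t)=f(x_t)\,dt+dL(t),\qquad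 \text{(2)}\ \ dX^{\epsilon}(t)=f(X^{\epsilon}_t)\,dt+\int_{0<|z|\le\epsilon}z\,\tilde N(dz,dt)\ \ (0<\epsilon<1),\qquad \text{(3)}\ \ dX(t)=f(X_t)\,dt$$ with initial value $x_0=X^\epsilon_0=X_0=\xi$. A unique global solution of (1) or (2) means a càdlàg $(\mathcal F_t)$-adapted process which almost surely satisfies the integrated equation for all $t\ge0$, which is adapted to the completed filtration generated by the driving noise of that equation (a strong solution), and with which every càdlàg $(\mathcal F_t)$-adapted solution on $[0,\tau)$, $\tau$ a stopping time, almost surely coincides on $[0,\tau)$. For (3) the same is meant for deterministic paths and deterministic $\tau$. (On $[0,\tau)$, the competing processes are restrictions of càdlàg processes on the whole time axis.) Assume: * $\nu$ is symmetric: $\nu(C)=\nu(-C)$ for every Borel set $C\subset\mathbb R^n$; * for every $\xi\in D_r$ (and every $\epsilon\in(0,1)$) there exist unique global solutions $x^\xi$, $X^{\epsilon,\xi}$, $X^\xi$ of (1), (2), (3), respectively; * $\lim_{t\to\infty}\|X^\xi_t\|_r=0$ for every $\xi\in D_r$; * for every $t>0$ and $\xi\in D_r$, $\|X^{\epsilon,\xi}_t-X^\xi_t\|_r\to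 0$ in probability as $\epsilon\to0$. Then $\{x^\xi\}_{\xi\in D_r}$ is weakly irreducible to $0$: for every $\xi\in D_r$, every $\lambda>0$ and every neighbourhood $U$ of $0$ in $D_r$, $$R_\lambda(\xi,U)=\lambda\int_0^\infty e^{-\lambda t}\,P(x^\xi_t\in U)\,dt>0 .$$ Moreover, for every $\xi\in D_r$ and $\kappa>0$ there is $T_0$ such that $P(\|x^\xi_T\|_r\le\kappa)>0$ for all $T>T_0$. -/

import Mathlib

open Set Filter Topology MeasureTheory ProbabilityTheory
open scoped NNReal ENNReal

noncomputable section

namespace DelaySDE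

/-! ### The fading-memory phase space -/

section PhaseSpace

/-- Right-continuous with left limits. On a half-line `Iic 0` nothing is asked from the right
of the end point. -/
def IsCadlag {T E : Type*} [TopologicalSpace T] [Preorder T] [TopologicalSpace E]
    (φ : T → E) : Prop :=
  ∀ t : T, ContinuousWithinAt φ (Ici t) t ∧ ∃ l : E, Tendsto φ (𝓝[<] t) (𝓝 l)

variable (E : Type*) [NormedAddCommGroup E] [NormedSpace ℝ E] (r : ℝ)

/-- The càdlàg functions `φ` on `(-∞, 0]` such that `e^{rθ} φ(θ)` converges as `θ → -∞`,
as a linear subspace of all functions. -/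
def phaseSubmodule : Submodule ℝ (Iic (0 : ℝ) → E) where
  carrier := {φ | IsCadlag φ ∧
    ∃ l : E, Tendsto (fun θ : Iic (0 : ℝ) => Real.exp (r * θ) • φ θ) atBot (𝓝 l)}
  zero_mem' := ⟨fun _ => ⟨continuousWithinAt_const, 0, tendsto_const_nhds⟩, 0, by simp⟩
  add_mem' := by
    rintro φ ψ ⟨h₁, l₁, hl₁⟩ ⟨h₂, l₂, hl₂⟩
    refine ⟨fun t => ⟨(h₁ t).1.add (h₂ t).1, ?_⟩, l₁ + l₂, ?_⟩
    · obtain ⟨a, ha⟩ := (h₁ t).2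
      obtain ⟨b, hb⟩ := (h₂ t).2
      exact ⟨a + b, ha.add hb⟩
    · simpa only [Pi.add_apply, smul_add] using hl₁.add hl₂
  smul_mem' := by
    rintro c φ ⟨h, l, hl⟩
    refine ⟨fun t => ⟨(h t).1.const_smul c, ?_⟩, c • l, ?_⟩
    · obtain ⟨a, ha⟩ := (h t).2
      exact ⟨c • a, ha.const_smul c⟩
    · refine (hl.const_smul c).congr fun θ => ?_
      simp only [Pi.smul_apply]
      rw [smul_comm]

/-- The phase space `D_r`. (A type of its own, so that it carries the weighted sup norm below and
not the topology of pointwise convergence.) -/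
def PhaseSpace : Type _ := ↥(phaseSubmodule E r)

instance : AddCommGroup (PhaseSpace E r) := inferInstanceAs (AddCommGroup ↥(phaseSubmodule E r))

instance : Module ℝ (PhaseSpace E r) := inferInstanceAs (Module ℝ ↥(phaseSubmodule E r))

instance : CoeFun (PhaseSpace E r) (fun _ => Iic (0 : ℝ) → E) := ⟨fun φ => φ.1⟩

/-- The weighted sup norm `‖φ‖_r = sup_{θ ≤ 0} e^{rθ} |φ(θ)|`. -/
instance : Norm (PhaseSpace E r) := ⟨fun φ => ⨆ θ : Iic (0 : ℝ), Real.exp (r * θ) * ‖φ θ‖⟩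

variable {E r}

theorem PhaseSpace.norm_def (φ : PhaseSpace E r) :
    ‖φ‖ = ⨆ θ : Iic (0 : ℝ), Real.exp (r * θ) * ‖φ θ‖ := rfl

@[simp] theorem PhaseSpace.add_apply (φ ψ : PhaseSpace E r) (θ : Iic (0 : ℝ)) :
    (φ + ψ) θ = φ θ + ψ θ := rfl

@[simp] theorem PhaseSpace.smul_apply (c : ℝ) (φ : PhaseSpace E r) (θ : Iic (0 : ℝ)) :
    (c • φ) θ = c • φ θ := rfl

@[simp] theorem PhaseSpace.zero_apply (θ : Iic (0 : ℝ)) : (0 : PhaseSpace E r) θ = 0 := rfl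

/-- The supremum in the norm is finite. -/
theorem PhaseSpace.bddAbove (φ : PhaseSpace E r) :
    BddAbove (range fun θ : Iic (0 : ℝ) => Real.exp (r * θ) * ‖φ θ‖) := by
  obtain ⟨hc, l, hl⟩ := φ.2
  have hg : ∀ θ : Iic (0 : ℝ), Real.exp (r * θ) * ‖φ θ‖ = ‖Real.exp (r * θ) • φ θ‖ := fun θ => by
    rw [norm_smul, Real.norm_eq_abs, abs_of_pos (Real.exp_pos _)]
  simp only [hg]
  set g : Iic (0 : ℝ) → ℝ := fun θ => ‖Real.exp (r * θ) • φ θ‖ with hgdef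
  have hcont : Continuous fun θ : Iic (0 : ℝ) => Real.exp (r * θ) := by fun_prop
  have hlim : ∀ᶠ θ in atBot, g θ ≤ ‖l‖ + 1 := by
    filter_upwards [hl.norm.eventually_lt_const (lt_add_one ‖l‖)] with θ hθ using hθ.le
  obtain ⟨a, ha⟩ := eventually_atBot.1 hlim
  have hcomp : IsCompact (Ici a) := by
    have he : Topology.IsClosedEmbedding (Subtype.val : Iic (0 : ℝ) → ℝ) :=
      isClosed_Iic.isClosedEmbedding_subtypeVal
    have h1 := he.isCompact_preimage (K := Icc (a : ℝ) 0) isCompact_Icc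
    refine h1.of_isClosed_subset isClosed_Ici fun θ hθ => ⟨hθ, θ.2⟩
  have hb : BddAbove (g '' Ici a) := by
    refine hcomp.induction_on (p := fun s => BddAbove (g '' s)) (by simp)
      (fun s t hst ht => ht.mono (image_mono hst))
      (fun s t hs ht => by rw [image_union]; exact hs.union ht) fun θ _ => ?_
    obtain ⟨hr, m, hm⟩ := hc θ
    have h1 : ∀ᶠ s in 𝓝[≥] θ, g s < g θ + 1 :=
      ((hcont.continuousWithinAt.smul hr).norm).eventually_lt_const (lt_add_one (g θ))
    have h2 : ∀ᶠ s in 𝓝[<] θ, g s < ‖Real.exp (r * θ) • m‖ + 1 := by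
      have h3 : Tendsto (fun s : Iic (0 : ℝ) => Real.exp (r * s)) (𝓝[<] θ)
          (𝓝 (Real.exp (r * θ))) := (hcont.tendsto θ).mono_left nhdsWithin_le_nhds
      exact (h3.smul hm).norm.eventually_lt_const (lt_add_one _)
    have h3 : ∀ᶠ s in 𝓝 θ, g s ≤ max (g θ + 1) (‖Real.exp (r * θ) • m‖ + 1) := by
      rw [← nhdsLT_sup_nhdsGE, eventually_sup]
      exact ⟨h2.mono fun s hs => hs.le.trans (le_max_right _ _),
        h1.mono fun s hs => hs.le.trans (le_max_left _ _)⟩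
    refine ⟨_, mem_nhdsWithin_of_mem_nhds h3,
      max (g θ + 1) (‖Real.exp (r * θ) • m‖ + 1), ?_⟩
    rintro _ ⟨s, hs, rfl⟩
    exact hs
  obtain ⟨B, hB⟩ := hb
  refine ⟨max B (‖l‖ + 1), ?_⟩
  rintro _ ⟨θ, rfl⟩
  rcases le_total θ a with h | h
  · exact (ha θ h).trans (le_max_right _ _)
  · exact (hB ⟨θ, h, rfl⟩).trans (le_max_left _ _)

theorem PhaseSpace.le_norm (φ : PhaseSpace E r) (θ : Iic (0 : ℝ)) :
    Real.exp (r * θ) * ‖φ θ‖ ≤ ‖φ‖ := le_ciSup φ.bddAbove θ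

theorem PhaseSpace.norm_le (φ : PhaseSpace E r) {C : ℝ}
    (h : ∀ θ : Iic (0 : ℝ), Real.exp (r * θ) * ‖φ θ‖ ≤ C) : ‖φ‖ ≤ C :=
  haveI : Nonempty (Iic (0 : ℝ)) := ⟨⟨0, self_mem_Iic⟩⟩
  ciSup_le h

theorem PhaseSpace.normCore : NormedSpace.Core ℝ (PhaseSpace E r) where
  norm_nonneg φ := Real.iSup_nonneg fun θ => by positivity
  norm_smul c φ := by
    rw [PhaseSpace.norm_def, PhaseSpace.norm_def, Real.mul_iSup_of_nonneg (norm_nonneg c)]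
    congr 1
    funext θ
    rw [PhaseSpace.smul_apply, norm_smul]
    ring
  norm_triangle φ ψ := PhaseSpace.norm_le _ fun θ => by
    have h := mul_le_mul_of_nonneg_left (norm_add_le (φ θ) (ψ θ)) (Real.exp_pos (r * θ)).le
    rw [mul_add] at h
    exact h.trans (add_le_add (φ.le_norm θ) (ψ.le_norm θ))
  norm_eq_zero_iff φ := by
    constructor
    · intro h
      refine Subtype.ext (funext fun θ => ?_)
      have h1 := φ.le_norm θ
      rw [h] at h1
      have h2 : ‖φ θ‖ ≤ 0 := by
        by_contra! h3
        exact absurd h1 (not_le.2 (mul_pos (Real.exp_pos _) h3))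
      exact norm_le_zero_iff.1 h2
    · rintro rfl
      simp [PhaseSpace.norm_def]

instance : NormedAddCommGroup (PhaseSpace E r) := NormedAddCommGroup.ofCore PhaseSpace.normCore

/-- The Borel σ-algebra of the norm topology. -/
instance : MeasurableSpace (PhaseSpace E r) := borel _

instance : BorelSpace (PhaseSpace E r) := ⟨rfl⟩

/-- The value `φ(0)`. -/
def PhaseSpace.present (φ : PhaseSpace E r) : E := φ ⟨0, self_mem_Iic⟩

variable (E r)

/-- Trajectories on the whole time axis: càdlàg `x : ℝ → E` such that `e^{rs} x(s)` converges
as `s → -∞`, i.e. those whose past up to any time belongs to the phase space. -/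
structure Trajectory where
  toFun : ℝ → E
  cadlag : IsCadlag toFun
  fading : ∃ l : E, Tendsto (fun s : ℝ => Real.exp (r * s) • toFun s) atBot (𝓝 l)

instance : CoeFun (Trajectory E r) (fun _ => ℝ → E) := ⟨Trajectory.toFun⟩

variable {E r}

/-- The segment `x_t = {x(t + θ) : θ ≤ 0}`. -/
def Trajectory.segment (x : Trajectory E r) (t : ℝ) : PhaseSpace E r :=
  ⟨fun θ => x (t + θ), by
    have hc : Continuous fun θ : Iic (0 : ℝ) => t + (θ : ℝ) := by fun_prop
    constructor
    · intro θ
      obtain ⟨h1, m, hm⟩ := x.cadlag (t + θ)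
      refine ⟨h1.comp (f := fun θ : Iic (0 : ℝ) => t + (θ : ℝ)) hc.continuousWithinAt
        (fun s hs => ?_), m, hm.comp ?_⟩
      · exact add_le_add_right (show (θ : ℝ) ≤ s from hs) t
      · refine tendsto_nhdsWithin_iff.2 ⟨(hc.tendsto θ).mono_left nhdsWithin_le_nhds, ?_⟩
        filter_upwards [self_mem_nhdsWithin] with s hs
        exact add_lt_add_right (show (s : ℝ) < θ from hs) t
    · obtain ⟨l, hl⟩ := x.fading
      have h1 : Tendsto (fun θ : Iic (0 : ℝ) => t + (θ : ℝ)) atBot atBot :=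
        tendsto_atBot_add_const_left _ _ (tendsto_comp_val_Iic_atBot.2 tendsto_id)
      refine ⟨Real.exp (-(r * t)) • l, ((hl.comp h1).const_smul (Real.exp (-(r * t)))).congr ?_⟩
      intro θ
      simp only [Function.comp_apply, smul_smul, ← Real.exp_add]
      congr 2
      ring⟩

@[simp] theorem Trajectory.segment_apply (x : Trajectory E r) (t : ℝ) (θ : Iic (0 : ℝ)) :
    x.segment t θ = x (t + θ) := rfl

end PhaseSpace

/-! ### Poisson random measures and the Lévy noise -/

section Noise

variable {Ω : Type*} [mΩ : MeasurableSpace Ω]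

/-- Lévy measures: no mass at `0`, and `∫ (|z|² ∧ 1) ν(dz) < ∞`. -/
structure IsLevyMeasure {E : Type*} [NormedAddCommGroup E] [MeasurableSpace E]
    (ν : Measure E) : Prop where
  zero : ν {0} = 0
  lintegral_lt_top : ∫⁻ z, ENNReal.ofReal (min (‖z‖ ^ 2) 1) ∂ν < ∞

/-- `ν(C) = ν(-C)` for all Borel sets `C`. -/
def IsSymmetricMeasure {E : Type*} [NormedAddCommGroup E] [MeasurableSpace E]
    (ν : Measure E) : Prop :=
  ∀ C : Set E, MeasurableSet C → ν C = ν ((fun z => -z) ⁻¹' C)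

/-- `N` is a Poisson random measure with intensity `m`. (For σ-finite `m`, sets of infinite
intensity then have infinite `N`-measure almost surely.) -/
structure IsPoissonRandomMeasure {S : Type*} [MeasurableSpace S] (P : Measure Ω)
    (N : Ω → Measure S) (m : Measure S) : Prop where
  measurable : ∀ A, MeasurableSet A → Measurable fun ω => N ω A
  integer : ∀ ω A, MeasurableSet A → ∃ k : ℕ∞, N ω A = (k : ℝ≥0∞)
  law : ∀ A, MeasurableSet A → m A ≠ ∞ →
    P.map (fun ω => N ω A) = (poissonMeasure (m A).toNNReal).map (fun k : ℕ => (k : ℝ≥0∞))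
  indep : ∀ (k : ℕ) (A : Fin k → Set S), (∀ i, MeasurableSet (A i)) →
    Pairwise (fun i j => Disjoint (A i) (A j)) → iIndepFun (fun i ω => N ω (A i)) P

variable {E : Type*} [NormedAddCommGroup E] [NormedSpace ℝ E] [MeasurableSpace E]

/-- `N` is a time-homogeneous Poisson random measure on (jump sizes) × (positive times) with
intensity `ν(dz) dt`, relative to the filtration `ℱ`: its restriction to times `≤ t` is
`ℱ t`-measurable, and its restriction to times `> t` is independent of `ℱ t`. -/
structure IsPoissonNoise (P : Measure Ω) (ℱ : Filtration ℝ≥0 mΩ)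
    (N : Ω → Measure (E × ℝ)) (ν : Measure E) : Prop where
  poisson : IsPoissonRandomMeasure P N (ν.prod (volume.restrict (Ioi (0 : ℝ))))
  adapted : ∀ (t : ℝ≥0) (A : Set (E × ℝ)), MeasurableSet A → A ⊆ univ ×ˢ Iic (t : ℝ) →
    Measurable[ℱ t] fun ω => N ω A
  indep : ∀ t : ℝ≥0, Indep (ℱ t)
    (⨆ A : {A : Set (E × ℝ) // MeasurableSet A ∧ A ⊆ univ ×ˢ Ioi (t : ℝ)},
      MeasurableSpace.comap (fun ω => N ω A.1) inferInstance) P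

/-- `∫₀ᵗ ∫_{δ < |z| ≤ ε} z Ñ(dz, ds)`, where `Ñ(dz, ds) = N(dz, ds) - ν(dz) ds`, for a point
configuration `N`. For `δ > 0` this is a finite sum of jumps minus a drift. -/
def truncatedCompensatedIntegral (ν : Measure E) (N : Measure (E × ℝ)) (δ ε : ℝ) (t : ℝ≥0) : E :=
  (∫ p in {z : E | δ < ‖z‖ ∧ ‖z‖ ≤ ε} ×ˢ Ioc (0 : ℝ) t, p.1 ∂N) -
    (t : ℝ) • ∫ z in {z : E | δ < ‖z‖ ∧ ‖z‖ ≤ ε}, z ∂ν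

/-- `∫₀ᵗ ∫_{0 < |z| ≤ ε} z Ñ(dz, ds)`, built pathwise as the limit `δ = 1/(k+1) → 0` of the
integrals over `δ < |z| ≤ ε`. For a Poisson random measure with Lévy intensity the limit exists
almost surely, locally uniformly in `t`, and agrees with the `L²` stochastic integral
(Lévy-Itô construction); off that almost sure event the value is irrelevant. -/
def smallJumpIntegral (ν : Measure E) (N : Ω → Measure (E × ℝ)) (ε : ℝ) (t : ℝ≥0) (ω : Ω) : E :=
  limUnder atTop fun k : ℕ => truncatedCompensatedIntegral ν (N ω) (1 / ((k : ℝ) + 1)) ε t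

/-- The Lévy process
`L(t) = ∫₀ᵗ ∫_{0 < |z| ≤ 1} z Ñ(dz, ds) + ∫₀ᵗ ∫_{|z| > 1} z N(dz, ds)`. -/
def levyProcess (ν : Measure E) (N : Ω → Measure (E × ℝ)) (t : ℝ≥0) (ω : Ω) : E :=
  smallJumpIntegral ν N 1 t ω + ∫ p in {z : E | 1 < ‖z‖} ×ˢ Ioc (0 : ℝ) t, p.1 ∂(N ω)

end Noise

/-! ### Functional equations and their solutions -/

section Equations

variable {E : Type*} [NormedAddCommGroup E] [NormedSpace ℝ E] {r : ℝ}

/-- The trajectory `x` starts from `ξ` and satisfies `x(t) = ξ(0) + ∫₀ᵗ f(x_s) ds + z(t)` for all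
`0 ≤ t < T`, where `z` is a given forcing path. -/
structure SolvesUpTo (f : PhaseSpace E r → E) (ξ : PhaseSpace E r) (z : ℝ≥0 → E)
    (T : WithTop ℝ≥0) (x : Trajectory E r) : Prop where
  initial : x.segment 0 = ξ
  integrable : ∀ t : ℝ≥0, (t : WithTop ℝ≥0) < T →
    IntervalIntegrable (fun s => f (x.segment s)) volume 0 t
  equation : ∀ t : ℝ≥0, (t : WithTop ℝ≥0) < T →
    x t = ξ.present + (∫ s in (0 : ℝ)..t, f (x.segment s)) + z t

/-- `x` is the unique global solution of the deterministic equation `dx(t) = f(x_t) dt`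
with initial value `ξ`. -/
structure IsUniqueDeterministicSolution (f : PhaseSpace E r → E) (ξ : PhaseSpace E r)
    (x : Trajectory E r) : Prop where
  solves : SolvesUpTo f ξ (fun _ => 0) ⊤ x
  unique : ∀ (T : WithTop ℝ≥0) (y : Trajectory E r), SolvesUpTo f ξ (fun _ => 0) T y →
    ∀ t : ℝ≥0, (t : WithTop ℝ≥0) < T → y t = x t

variable {Ω : Type*} [mΩ : MeasurableSpace Ω] [MeasurableSpace E]

/-- `X` is an `ℱ`-adapted càdlàg process that almost surely solves `dX(t) = f(X_t) dt + dZ(t)`,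
`X_0 = ξ`, on the random time interval `[0, τ)`. -/
structure IsSolutionUpTo (P : Measure Ω) (ℱ : Filtration ℝ≥0 mΩ) (f : PhaseSpace E r → E)
    (ξ : PhaseSpace E r) (Z : ℝ≥0 → Ω → E) (τ : Ω → WithTop ℝ≥0) (X : Ω → Trajectory E r) :
    Prop where
  adapted : ∀ t : ℝ≥0, Measurable[ℱ t] fun ω => X ω t
  solves : ∀ᵐ ω ∂P, SolvesUpTo f ξ (fun t => Z t ω) (τ ω) (X ω)

/-- `X` is the unique global (strong) solution of `dX(t) = f(X_t) dt + dZ(t)`, `X_0 = ξ`: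
it solves the equation for all times, it is adapted to the completed filtration generated by the
driving noise `Z`, and every `ℱ`-adapted solution on `[0, τ)`, `τ` a stopping time, coincides
with it there, almost surely. -/
structure IsUniqueGlobalSolution (P : Measure Ω) (ℱ : Filtration ℝ≥0 mΩ)
    (f : PhaseSpace E r → E) (ξ : PhaseSpace E r) (Z : ℝ≥0 → Ω → E) (X : Ω → Trajectory E r) :
    Prop where
  solution : IsSolutionUpTo P ℱ f ξ Z (fun _ => ⊤) X
  strong : ∀ t : ℝ≥0, AEStronglyMeasurable[⨆ s : Iic t, MeasurableSpace.comap (Z s) inferInstance]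
    (fun ω => X ω t) P
  unique : ∀ τ : Ω → WithTop ℝ≥0, IsStoppingTime ℱ τ → ∀ Y : Ω → Trajectory E r,
    IsSolutionUpTo P ℱ f ξ Z τ Y →
      ∀ᵐ ω ∂P, ∀ t : ℝ≥0, (t : WithTop ℝ≥0) < τ ω → Y ω t = X ω t

end Equations

/-! ### Weak irreducibility -/

section Irreducibility

variable {Ω H : Type*} [MeasurableSpace Ω]

/-- The resolvent `R_λ(U) = λ ∫₀^∞ e^{-λt} P(Y(t) ∈ U) dt` of a process `Y`. -/
def resolvent (P : Measure Ω) (Y : ℝ → Ω → H) (lam : ℝ) (U : Set H) : ℝ≥0∞ :=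
  ENNReal.ofReal lam *
    ∫⁻ t in Ioi (0 : ℝ), ENNReal.ofReal (Real.exp (-(lam * t))) * P {ω | Y t ω ∈ U}

/-- The family `Y ξ`, `ξ ∈ H`, is weakly irreducible (accessible) to `ξ₀`: `R_λ(ξ, U) > 0` for
all `ξ`, all `λ > 0` and all neighbourhoods `U` of `ξ₀`. -/
def IsWeaklyIrreducibleTo [TopologicalSpace H] (P : Measure Ω) (Y : H → ℝ → Ω → H) (ξ₀ : H) :
    Prop :=
  ∀ ξ : H, ∀ U ∈ 𝓝 ξ₀, ∀ lam : ℝ, 0 < lam → 0 < resolvent P (Y ξ) lam U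

end Irreducibility

end DelaySDE

end

/-!
The solution of the full equation stays close to the deterministic solution, hence close to `0`,
on an event of positive probability: no jump larger than `ε` occurs up to the time in question,
and the equation driven by the remaining small jumps behaves like the deterministic one.

Since `ν` is symmetric, the compensator of the jumps of size in `(ε, 1]` vanishes. Thus as long as
no jump exceeds `ε`, the Lévy process coincides path by path with its small-jump part
(`levyProcess_eq_of_void`). The time of the first jump larger than `ε` is a stopping time, because
the filtration is right-continuous, and pathwise uniqueness identifies the solution of the full
equation with that of the truncated equation before this time (`ae_eq_before_firstLargeJump`).

The absence of large jumps up to a finite time has positive probability, as the Lévy measure of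
`{|z| > ε}` is finite (`IsPoissonRandomMeasure.void_pos`). It is independent of the truncated
solution, which is a strong solution and so depends only on the restriction of the Poisson random
measure to `{|z| ≤ ε}` (`IsPoissonRandomMeasure.indep_regionSigma`, `exists_regionSigma_ae_eq`).
At a late time the deterministic segment has small norm, and by convergence in probability so has
the truncated one with positive probability, once `ε` is small. The product of the two
probabilities is a lower bound (`measure_norm_segment_le_pos`).

For the resolvent, `e^{rt} ‖x_t‖_r = sup_{s ≤ t} e^{rs} |x(s)|` is nondecreasing in `t`, which turns
positivity at one time into a uniform lower bound on a time interval (`resolvent_pos`).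
-/

noncomputable section

namespace DelaySDE

/-! ### Independence and void probabilities of Poisson random measures -/

section PoissonRandomMeasure

variable {Ω S : Type*} [MeasurableSpace S]

/-- The σ-algebra generated by the restriction of the random measure `N` to the region `R`, that
is, by the masses `N A` of the measurable sets `A ⊆ R`. -/
@[reducible] def regionSigma (N : Ω → Measure S) (R : Set S) : MeasurableSpace Ω :=
  ⨆ A : {A : Set S // MeasurableSet A ∧ A ⊆ R},
    MeasurableSpace.comap (fun ω => N ω A.1) inferInstance

theorem measurable_regionSigma (N : Ω → Measure S) {R A : Set S} (hA : MeasurableSet A)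
    (hAR : A ⊆ R) : Measurable[regionSigma N R] fun ω => N ω A :=
  Measurable.of_comap_le (le_iSup (fun A : {A : Set S // MeasurableSet A ∧ A ⊆ R} =>
    MeasurableSpace.comap (fun ω => N ω A.1) inferInstance) ⟨A, hA, hAR⟩)

variable [mΩ : MeasurableSpace Ω] {P : Measure Ω} {N : Ω → Measure S} {m : Measure S}

theorem IsPoissonRandomMeasure.regionSigma_le (hN : IsPoissonRandomMeasure P N m) (R : Set S) :
    regionSigma N R ≤ mΩ :=
  iSup_le fun A => (hN.measurable A.1 A.2.1).comap_le

theorem IsPoissonRandomMeasure.iIndepFun_of_fintype {ι : Type*} [Fintype ι]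
    (hN : IsPoissonRandomMeasure P N m) {A : ι → Set S} (hA : ∀ i, MeasurableSet (A i))
    (hd : Pairwise fun i j => Disjoint (A i) (A j)) : iIndepFun (fun i ω => N ω (A i)) P := by
  let e := (Fintype.equivFin ι).symm
  refine iIndepFun.of_precomp (g := e) e.surjective ?_
  exact hN.indep _ (fun i => A (e i)) (fun i => hA _) fun i j hij => hd (e.injective.ne hij)

/-- The restriction of a Poisson random measure to a region is independent of the mass of a set
disjoint from it. Finitely many sets in the region are unions of the atoms that they generate, so
the independence over disjoint sets extends to them; the rest is a monotone limit. -/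
theorem IsPoissonRandomMeasure.indep_regionSigma [IsProbabilityMeasure P]
    (hN : IsPoissonRandomMeasure P N m) {R A : Set S} (hA : MeasurableSet A)
    (hRA : Disjoint R A) :
    Indep (regionSigma N R) (MeasurableSpace.comap (fun ω => N ω A) inferInstance) P := by
  classical
  rw [regionSigma, iSup_eq_iSup_finset]
  refine indep_iSup_of_monotone (fun F => ?_)
    (fun F => iSup₂_le fun B _ => (hN.measurable B.1 B.2.1).comap_le)
    (hN.measurable A hA).comap_le (fun F G h => biSup_mono fun B hB => Finset.mem_of_subset h hB)
  -- the atoms are the fibres of the map recording membership in each set of `F`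
  let φ : S → F → Bool := fun p B => decide (p ∈ B.1.1)
  have hφ : Measurable φ := by
    refine measurable_pi_lambda _ fun B => ?_
    exact measurable_to_bool (by simpa [φ, preimage] using B.1.2.1)
  let C : Option (F → Bool) → Set S := fun o => o.elim A fun b => φ ⁻¹' {b} \ A
  have hC : ∀ o, MeasurableSet (C o) := by
    rintro (_ | b)
    · exact hA
    · exact (hφ (measurableSet_singleton b)).diff hA
  have hd : Pairwise fun i j => Disjoint (C i) (C j) := by
    rintro (_ | b) (_ | c) h
    · exact absurd rfl h
    · exact disjoint_sdiff_right
    · exact disjoint_sdiff_left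
    · refine Disjoint.mono sdiff_subset sdiff_subset (Disjoint.preimage _ ?_)
      simpa using fun h' => h (by rw [h'])
  have hind := indep_iSup_of_disjoint (fun o => (hN.measurable (C o) (hC o)).comap_le)
    (hN.iIndepFun_of_fintype hC hd) (S := range some) (T := {none}) (by simp)
  refine indep_of_indep_of_le_left (indep_of_indep_of_le_right hind ?_) ?_
  · exact le_iSup₂_of_le none rfl le_rfl
  · refine iSup₂_le fun B hB => Measurable.comap_le ?_
    have hBA : ∀ ω, N ω B.1 =
        ∑ b ∈ Finset.univ.filter (fun b : F → Bool => b ⟨B, hB⟩ = true), N ω (C (some b)) := by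
      intro ω
      rw [← measure_biUnion_finset]
      · congr 1
        ext p
        simp only [Finset.mem_filter, Finset.mem_univ, true_and, mem_iUnion, C, Option.elim,
          Set.mem_sdiff, mem_preimage, mem_singleton_iff, exists_prop]
        constructor
        · intro hp
          exact ⟨φ p, by simpa [φ] using hp, rfl, fun hpA => hRA.le_bot ⟨B.2.2 hp, hpA⟩⟩
        · rintro ⟨b, hb, rfl, -⟩
          simpa [φ] using hb
      · intro b _ c _ hbc
        exact hd fun h => hbc (Option.some_injective _ h)
      · exact fun b _ => hC _
    simp only [hBA]
    refine Finset.measurable_sum _ fun b _ => Measurable.of_comap_le ?_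
    exact le_iSup₂_of_le (some b) (mem_range_self b) le_rfl

/-- A set of finite intensity `m A` carries no point with probability `e^{-m A} > 0`. -/
theorem IsPoissonRandomMeasure.void_pos (hN : IsPoissonRandomMeasure P N m) {A : Set S}
    (hA : MeasurableSet A) (hm : m A ≠ ∞) : 0 < P {ω | N ω A = 0} := by
  have h : P {ω | N ω A = 0} = (P.map fun ω => N ω A) {0} :=
    (Measure.map_apply (hN.measurable A hA) (measurableSet_singleton 0)).symm
  have h0 : (fun k : ℕ => (k : ℝ≥0∞)) ⁻¹' {0} = {0} := by
    ext k
    simp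
  rw [h, hN.law A hA hm, Measure.map_apply (measurable_of_countable _) (measurableSet_singleton 0),
    h0, poissonMeasure_singleton]
  simp [Real.exp_pos]

end PoissonRandomMeasure

/-! ### The small jumps -/

section SmallJumps

variable {E : Type*} [NormedAddCommGroup E] [MeasurableSpace E] [BorelSpace E] {ν : Measure E}

theorem IsLevyMeasure.measure_norm_gt_ne_top (hν : IsLevyMeasure ν) {ε : ℝ} (hε : 0 < ε) :
    ν {z | ε < ‖z‖} ≠ ∞ := by
  have hc : ENNReal.ofReal (min (ε ^ 2) 1) ≠ 0 := by
    simpa using hε.ne'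
  refine ne_top_of_le_ne_top ?_ (measure_mono (t := {z : E | ENNReal.ofReal (min (ε ^ 2) 1) ≤
    ENNReal.ofReal (min (‖z‖ ^ 2) 1)}) fun z hz => ?_)
  · exact (lt_of_le_of_lt (meas_ge_le_lintegral_div (by fun_prop) hc ENNReal.ofReal_ne_top)
      (ENNReal.div_lt_top hν.lintegral_lt_top.ne hc)).ne
  · exact ENNReal.ofReal_le_ofReal (min_le_min_right _
      (pow_le_pow_left₀ hε.le (le_of_lt hz) 2))

theorem measurableSet_annulus_prod (δ ε : ℝ) (t : ℝ≥0) :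
    MeasurableSet ({z : E | δ < ‖z‖ ∧ ‖z‖ ≤ ε} ×ˢ Ioc (0 : ℝ) t) :=
  ((measurableSet_lt measurable_const measurable_norm).inter
    (measurableSet_le measurable_norm measurable_const)).prod measurableSet_Ioc

variable [NormedSpace ℝ E]

theorem IsSymmetricMeasure.setIntegral_eq_zero (hν : IsSymmetricMeasure ν) (δ ε : ℝ) :
    ∫ z in {z : E | δ < ‖z‖ ∧ ‖z‖ ≤ ε}, z ∂ν = 0 := by
  have hmap : MeasurePreserving (fun z : E => -z) ν ν :=
    ⟨measurable_neg, Measure.ext fun C hC => by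
      rw [Measure.map_apply measurable_neg hC, ← hν C hC]⟩
  have h := hmap.setIntegral_preimage_emb (MeasurableEquiv.neg E).measurableEmbedding
    (fun z => z) {z : E | δ < ‖z‖ ∧ ‖z‖ ≤ ε}
  simp only [preimage_ofPred_eq, norm_neg] at h
  rw [integral_neg] at h
  have h2 := eq_neg_iff_add_eq_zero.1 h.symm
  rw [← two_smul ℝ] at h2
  exact (smul_eq_zero.1 h2).resolve_left two_ne_zero

/-- By symmetry of `ν` nothing is compensated, so the integral over jumps of size at most `ε'`
agrees with the one over jumps of size at most `ε` as long as no jump exceeds `ε`. -/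
theorem smallJumpIntegral_eq_of_void {Ω : Type*} {N : Ω → Measure (E × ℝ)}
    (hν : IsSymmetricMeasure ν) {ε ε' : ℝ} (hε : ε ≤ ε') {t : ℝ≥0} {ω : Ω}
    (h : N ω ({z | ε < ‖z‖} ×ˢ Ioc (0 : ℝ) t) = 0) :
    smallJumpIntegral ν N ε' t ω = smallJumpIntegral ν N ε t ω := by
  unfold smallJumpIntegral
  congr 1
  funext k
  simp only [truncatedCompensatedIntegral, hν.setIntegral_eq_zero, smul_zero, sub_zero]
  refine setIntegral_congr_set ?_
  have h' : ∀ᵐ p ∂N ω, p ∉ {z : E | ε < ‖z‖} ×ˢ Ioc (0 : ℝ) t := measure_eq_zero_iff_ae_notMem.1 h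
  filter_upwards [h'] with p hp
  refine propext ⟨?_, ?_⟩
  · rintro ⟨⟨h1, h2⟩, h3⟩
    exact ⟨⟨h1, not_lt.1 fun h4 => hp ⟨h4, h3⟩⟩, h3⟩
  · rintro ⟨⟨h1, h2⟩, h3⟩
    exact ⟨⟨h1, h2.trans hε⟩, h3⟩

theorem levyProcess_eq_of_void {Ω : Type*} {N : Ω → Measure (E × ℝ)}
    (hν : IsSymmetricMeasure ν) {ε : ℝ} (hε : ε ≤ 1) {t : ℝ≥0} {ω : Ω}
    (h : N ω ({z | ε < ‖z‖} ×ˢ Ioc (0 : ℝ) t) = 0) :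
    levyProcess ν N t ω = smallJumpIntegral ν N ε t ω := by
  have h1 : N ω ({z : E | 1 < ‖z‖} ×ˢ Ioc (0 : ℝ) t) = 0 :=
    measure_mono_null (prod_mono_left fun z (hz : 1 < ‖z‖) => lt_of_le_of_lt hε hz) h
  rw [levyProcess, smallJumpIntegral_eq_of_void hν hε h, setIntegral_measure_zero _ h1, add_zero]

theorem stronglyMeasurable_smallJumpIntegral {Ω : Type*} [SecondCountableTopology E]
    [CompleteSpace E] (N : Ω → Measure (E × ℝ)) (ε : ℝ) (t : ℝ≥0) :
    StronglyMeasurable[regionSigma N ({z | ‖z‖ ≤ ε} ×ˢ univ)]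
      (smallJumpIntegral ν N ε t) := by
  let _ : MeasurableSpace Ω := regionSigma N ({z | ‖z‖ ≤ ε} ×ˢ univ)
  refine StronglyMeasurable.limUnder fun k => ?_
  refine StronglyMeasurable.sub ?_ stronglyMeasurable_const
  set B := {z : E | 1 / ((k : ℝ) + 1) < ‖z‖ ∧ ‖z‖ ≤ ε} ×ˢ Ioc (0 : ℝ) t with hB
  have hBm : MeasurableSet B := measurableSet_annulus_prod _ _ _
  let κ : Kernel Ω (E × ℝ) :=
    { toFun := fun ω => (N ω).restrict B
      measurable' := Measure.measurable_of_measurable_coe _ fun A hA => by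
        simp only [Measure.restrict_apply hA]
        exact measurable_regionSigma N (hA.inter hBm)
          fun p hp => ⟨hp.2.1.2, mem_univ _⟩ }
  exact StronglyMeasurable.integral_kernel (κ := κ) (f := Prod.fst) measurable_fst.stronglyMeasurable

end SmallJumps

/-! ### The weighted norm of a segment -/

section Segments

variable {E : Type*} [NormedAddCommGroup E] [NormedSpace ℝ E] {r : ℝ}

theorem Trajectory.norm_segment_le_iff (x : Trajectory E r) (T κ : ℝ) :
    ‖x.segment T‖ ≤ κ ↔ ∀ s ≤ T, Real.exp (r * (s - T)) * ‖x s‖ ≤ κ := by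
  constructor
  · intro h s hs
    have := (x.segment T).le_norm ⟨s - T, sub_nonpos.2 hs⟩
    rw [Trajectory.segment_apply] at this
    simp only [add_sub_cancel] at this
    exact this.trans h
  · intro h
    refine PhaseSpace.norm_le _ fun θ => ?_
    have := h (T + θ) (by have : (θ : ℝ) ≤ 0 := θ.2; linarith)
    rwa [add_sub_cancel_left] at this

theorem Trajectory.apply_of_segment_zero {x : Trajectory E r} {ξ : PhaseSpace E r}
    (h : x.segment 0 = ξ) {s : ℝ} (hs : s ≤ 0) : x s = ξ ⟨s, hs⟩ := by
  rw [← h, Trajectory.segment_apply, zero_add]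

/-- `e^{rT} ‖x_T‖` is nondecreasing in `T`, in multiplicative form. -/
theorem Trajectory.norm_segment_le_of_le (x : Trajectory E r) {t T κ : ℝ} (htT : t ≤ T)
    (h : ‖x.segment T‖ ≤ Real.exp (-(r * (T - t))) * κ) : ‖x.segment t‖ ≤ κ := by
  rw [Trajectory.norm_segment_le_iff] at h ⊢
  intro s hs
  have h1 := h s (hs.trans htT)
  have h2 : Real.exp (r * (s - T)) = Real.exp (-(r * (T - t))) * Real.exp (r * (s - t)) := by
    rw [← Real.exp_add]
    congr 1
    ring
  rw [h2, mul_assoc] at h1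
  exact le_of_mul_le_mul_left h1 (Real.exp_pos _)

/-- By right continuity, the weighted norm of a segment is controlled by the initial segment and
by the values at the end point and at the rational times before it. -/
theorem Trajectory.norm_segment_le_iff_rat {x : Trajectory E r} {ξ : PhaseSpace E r}
    (h0 : x.segment 0 = ξ) (T : ℝ≥0) (κ : ℝ) :
    ‖x.segment T‖ ≤ κ ↔ (∀ θ : Iic (0 : ℝ), Real.exp (r * (θ - T)) * ‖ξ θ‖ ≤ κ) ∧
      ‖x T‖ ≤ κ ∧
        ∀ q : ℚ≥0, (q : ℝ) ≤ T → Real.exp (r * (q - T)) * ‖x (q : ℝ)‖ ≤ κ := by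
  rw [Trajectory.norm_segment_le_iff]
  constructor
  · refine fun h => ⟨fun θ => ?_, ?_, fun q hq => ?_⟩
    · have := h θ (le_trans θ.2 T.2)
      rwa [Trajectory.apply_of_segment_zero h0 θ.2] at this
    · simpa using h T le_rfl
    · simpa using h q hq
  · rintro ⟨hpast, hend, hrat⟩ s hs
    rcases le_total s 0 with hs0 | hs0
    · rw [Trajectory.apply_of_segment_zero h0 hs0]
      exact hpast ⟨s, hs0⟩
    rcases hs.eq_or_lt with rfl | hlt
    · simpa using hend
    by_contra! hcon
    have hcont : ContinuousWithinAt (fun u => Real.exp (r * (u - T)) * ‖x u‖) (Ici s) s :=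
      (Continuous.continuousWithinAt (by fun_prop)).mul (x.cadlag s).1.norm
    have hev := hcont.eventually_const_lt hcon
    obtain ⟨u, hu, hsub⟩ := (mem_nhdsGE_iff_exists_Ico_subset' hlt).1 hev
    obtain ⟨q, hq1, hq2⟩ := exists_rat_btwn (lt_min hu hlt)
    have hq0 : (0 : ℚ) ≤ q := by exact_mod_cast hs0.trans hq1.le
    have h1 := hrat ⟨q, hq0⟩ (hq2.trans_le (min_le_right _ _)).le
    have h2 : κ < Real.exp (r * (q - T)) * ‖x (q : ℝ)‖ :=
      hsub ⟨hq1.le, hq2.trans_le (min_le_left _ _)⟩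
    exact absurd h1 (not_le.2 h2)

end Segments

/-! ### The first large jump -/

theorem coe_nnratCast_nnreal (q : ℚ≥0) : ((q : ℝ≥0) : ℝ) = q := rfl

section FirstLargeJump

variable {Ω E : Type*} [NormedAddCommGroup E] [MeasurableSpace E]

/-- The time of the first jump of size larger than `ε`, and `⊤` if there is none. The infimum runs
over rational times, so that its measurability is immediate. -/
def firstLargeJump (N : Ω → Measure (E × ℝ)) (ε : ℝ) (ω : Ω) : WithTop ℝ≥0 :=
  ⨅ q : {q : ℚ≥0 // N ω ({z | ε < ‖z‖} ×ˢ Ioc (0 : ℝ) (q : ℝ≥0)) ≠ 0}, ((q.1 : ℝ≥0) : WithTop ℝ≥0)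

theorem firstLargeJump_lt_iff {N : Ω → Measure (E × ℝ)} {ε : ℝ} {ω : Ω} {t : WithTop ℝ≥0} :
    firstLargeJump N ε ω < t ↔ ∃ q : ℚ≥0, ((q : ℝ≥0) : WithTop ℝ≥0) < t ∧
      N ω ({z | ε < ‖z‖} ×ˢ Ioc (0 : ℝ) (q : ℝ≥0)) ≠ 0 := by
  rw [firstLargeJump, iInf_lt_iff]
  exact ⟨fun ⟨q, hq⟩ => ⟨q.1, hq, q.2⟩, fun ⟨q, hq, h⟩ => ⟨⟨q, h⟩, hq⟩⟩

theorem void_of_lt_firstLargeJump {N : Ω → Measure (E × ℝ)} {ε : ℝ} {ω : Ω} {t : ℝ≥0}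
    (h : (t : WithTop ℝ≥0) < firstLargeJump N ε ω) :
    N ω ({z | ε < ‖z‖} ×ˢ Ioc (0 : ℝ) t) = 0 := by
  obtain ⟨s, hts, hs⟩ : ∃ s : ℝ≥0, t < s ∧ (s : WithTop ℝ≥0) ≤ firstLargeJump N ε ω := by
    cases hτ : firstLargeJump N ε ω with
    | top => exact ⟨t + 1, lt_add_one t, le_top⟩
    | coe s => exact ⟨s, by rw [hτ] at h; exact_mod_cast h, le_rfl⟩
  obtain ⟨q, htq, hqs⟩ := exists_rat_btwn (NNReal.coe_lt_coe.2 hts)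
  have hq0 : (0 : ℚ) ≤ q := by exact_mod_cast t.2.trans htq.le
  lift q to ℚ≥0 using hq0
  have htq' : t < (q : ℝ≥0) := by
    rw [← NNReal.coe_lt_coe, coe_nnratCast_nnreal]
    exact_mod_cast htq
  have hqs' : (q : ℝ≥0) < s := by
    rw [← NNReal.coe_lt_coe, coe_nnratCast_nnreal]
    exact_mod_cast hqs
  by_contra hne
  refine absurd (firstLargeJump_lt_iff.2 ⟨q, lt_of_lt_of_le ?_ hs, ?_⟩) (lt_irrefl _)
  · exact_mod_cast hqs'
  · refine fun h0 => hne (measure_mono_null (prod_mono_right (Ioc_subset_Ioc_right ?_)) h0)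
    exact_mod_cast htq'.le

theorem le_firstLargeJump_of_void {N : Ω → Measure (E × ℝ)} {ε : ℝ} {ω : Ω} {t : ℝ≥0}
    (h : N ω ({z | ε < ‖z‖} ×ˢ Ioc (0 : ℝ) t) = 0) :
    (t : WithTop ℝ≥0) ≤ firstLargeJump N ε ω := by
  by_contra! hlt
  obtain ⟨q, hq, hne⟩ := firstLargeJump_lt_iff.1 hlt
  refine hne (measure_mono_null (prod_mono_right (Ioc_subset_Ioc_right ?_)) h)
  exact_mod_cast hq.le

variable [BorelSpace E] [mΩ : MeasurableSpace Ω]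

theorem measurableSet_largeJumps (ε : ℝ) (t : ℝ≥0) :
    MeasurableSet ({z : E | ε < ‖z‖} ×ˢ Ioc (0 : ℝ) t) :=
  (measurableSet_lt measurable_const measurable_norm).prod measurableSet_Ioc

theorem IsPoissonNoise.isStoppingTime_firstLargeJump [NormedSpace ℝ E] {P : Measure Ω}
    {ℱ : Filtration ℝ≥0 mΩ} [ℱ.IsRightContinuous] {N : Ω → Measure (E × ℝ)} {ν : Measure E}
    (hN : IsPoissonNoise P ℱ N ν) (ε : ℝ) : IsStoppingTime ℱ (firstLargeJump N ε) := by
  refine isStoppingTime_of_measurableSet_lt_of_isRightContinuous fun t => ?_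
  simp only [firstLargeJump_lt_iff, ofPred_exists]
  refine MeasurableSet.iUnion fun q => ?_
  by_cases hq : ((q : ℝ≥0) : WithTop ℝ≥0) < t
  · have hqt : (q : ℝ≥0) ≤ t := by exact_mod_cast hq.le
    have hm : Measurable[ℱ t] fun ω => N ω ({z : E | ε < ‖z‖} ×ˢ Ioc (0 : ℝ) (q : ℝ≥0)) :=
      hN.adapted t _ (measurableSet_largeJumps ε _)
        (prod_mono (subset_univ _) fun s hs => hs.2.trans hqt)
    simp only [hq, true_and]
    exact hm (measurableSet_singleton 0).compl
  · simp only [hq, false_and]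
    exact MeasurableSet.const False

end FirstLargeJump

/-! ### Comparison of the equations -/

theorem measurableSet_rational_bounds {Ω E : Type*} {_ : MeasurableSpace Ω} [NormedAddCommGroup E]
    {g : ℝ≥0 → Ω → E} (p : Prop) (r : ℝ) (T : ℝ≥0) (κ : ℝ) (hg : ∀ t, StronglyMeasurable (g t)) :
    MeasurableSet {ω | p ∧ ‖g T ω‖ ≤ κ ∧
      ∀ q : ℚ≥0, (q : ℝ) ≤ T → Real.exp (r * (q - T)) * ‖g q ω‖ ≤ κ} := by
  have hm := fun t => (hg t).norm.measurable
  simp only [ofPred_and, ofPred_forall]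
  refine .inter (.const p) (.inter (measurableSet_le (hm T) measurable_const) ?_)
  exact .iInter fun q => .iInter fun _ => measurableSet_le ((hm q).const_mul _) measurable_const

section Comparison

variable {Ω : Type*} [mΩ : MeasurableSpace Ω] {P : Measure Ω} {ℱ : Filtration ℝ≥0 mΩ}
  {E : Type*} [NormedAddCommGroup E] [NormedSpace ℝ E] [MeasurableSpace E] [BorelSpace E] {r : ℝ}
  {ν : Measure E} {N : Ω → Measure (E × ℝ)} {f : PhaseSpace E r → E} {ξ : PhaseSpace E r}
  {x Y : Ω → Trajectory E r} {ε : ℝ}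

/-- Before the first jump larger than `ε`, the solution driven by the Lévy process is the solution
driven by its jumps of size at most `ε`. -/
theorem ae_eq_before_firstLargeJump [ℱ.IsRightContinuous] (hN : IsPoissonNoise P ℱ N ν)
    (hsymm : IsSymmetricMeasure ν) (hε : ε ≤ 1)
    (hx : IsUniqueGlobalSolution P ℱ f ξ (levyProcess ν N) x)
    (hY : IsUniqueGlobalSolution P ℱ f ξ (smallJumpIntegral ν N ε) Y) :
    ∀ᵐ ω ∂P, ∀ t : ℝ≥0, (t : WithTop ℝ≥0) < firstLargeJump N ε ω → Y ω t = x ω t := by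
  refine hx.unique _ (hN.isStoppingTime_firstLargeJump ε) Y ⟨hY.solution.adapted, ?_⟩
  filter_upwards [hY.solution.solves] with ω hω
  refine ⟨hω.initial, fun t _ => hω.integrable t (WithTop.coe_lt_top t), fun t ht => ?_⟩
  rw [levyProcess_eq_of_void hsymm hε (void_of_lt_firstLargeJump ht)]
  exact hω.equation t (WithTop.coe_lt_top t)

theorem ae_segment_eq_of_void [ℱ.IsRightContinuous] (hN : IsPoissonNoise P ℱ N ν)
    (hsymm : IsSymmetricMeasure ν) (hε : ε ≤ 1)
    (hx : IsUniqueGlobalSolution P ℱ f ξ (levyProcess ν N) x)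
    (hY : IsUniqueGlobalSolution P ℱ f ξ (smallJumpIntegral ν N ε) Y) {T T' : ℝ≥0} (hT : T < T') :
    ∀ᵐ ω ∂P, N ω ({z | ε < ‖z‖} ×ˢ Ioc (0 : ℝ) T') = 0 →
      (x ω).segment T = (Y ω).segment T := by
  filter_upwards [ae_eq_before_firstLargeJump hN hsymm hε hx hY, hx.solution.solves,
    hY.solution.solves] with ω h hxω hYω hvoid
  refine Subtype.ext (funext fun θ => ?_)
  change x ω (T + θ) = Y ω (T + θ)
  have hθ : (θ : ℝ) ≤ 0 := θ.2
  rcases le_total ((T : ℝ) + θ) 0 with h0 | h0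
  · rw [Trajectory.apply_of_segment_zero hxω.initial h0,
      Trajectory.apply_of_segment_zero hYω.initial h0]
  · obtain ⟨u, hu⟩ : ∃ u : ℝ≥0, (u : ℝ) = T + θ := ⟨⟨T + θ, h0⟩, rfl⟩
    rw [← hu]
    refine (h u (lt_of_lt_of_le ?_ (le_firstLargeJump_of_void hvoid))).symm
    refine WithTop.coe_lt_coe.2 (lt_of_le_of_lt ?_ hT)
    rw [← NNReal.coe_le_coe, hu]
    exact add_le_of_nonpos_right hθ

/-- Up to a null set, the event that a segment of a strong solution driven by the small jumps is
small belongs to the σ-algebra generated by these jumps. -/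
theorem exists_regionSigma_ae_eq [SecondCountableTopology E] [CompleteSpace E]
    (hY : IsUniqueGlobalSolution P ℱ f ξ (smallJumpIntegral ν N ε) Y) (T : ℝ≥0) (κ : ℝ) :
    ∃ A : Set Ω, MeasurableSet[regionSigma N ({z | ‖z‖ ≤ ε} ×ˢ univ)] A ∧
      A =ᵐ[P] {ω | ‖(Y ω).segment T‖ ≤ κ} := by
  have hstrong : ∀ t : ℝ≥0, ∃ g : Ω → E,
      StronglyMeasurable[regionSigma N ({z | ‖z‖ ≤ ε} ×ˢ univ)] g ∧
        (fun ω => Y ω t) =ᵐ[P] g := by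
    intro t
    have hle : (⨆ s : Iic t, MeasurableSpace.comap (smallJumpIntegral ν N ε s) inferInstance) ≤
        regionSigma N ({z : E | ‖z‖ ≤ ε} ×ˢ univ) :=
      iSup_le fun s => (stronglyMeasurable_smallJumpIntegral N ε s.1).measurable.comap_le
    exact (hY.strong t).mono hle
  choose g hg hYg using hstrong
  refine ⟨_, measurableSet_rational_bounds
    (∀ θ : Iic (0 : ℝ), Real.exp (r * (θ - T)) * ‖ξ θ‖ ≤ κ) r T κ fun t => hg t, ?_⟩
  filter_upwards [hY.solution.solves, hYg T, ae_all_iff.2 fun q : ℚ≥0 => hYg (q : ℝ≥0)]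
    with ω hω hT hq
  change (_ ∧ _ ∧ _) = (‖(Y ω).segment T‖ ≤ κ)
  refine propext (Iff.trans ?_ (Trajectory.norm_segment_le_iff_rat hω.initial T κ).symm)
  simp only [← hT, ← hq, coe_nnratCast_nnreal]

/-- The event that the truncated equation has a small segment and the event of no large jump are
independent; on both, the segment of the solution driven by the Lévy process is small. -/
theorem measure_norm_segment_le_pos [IsProbabilityMeasure P] [ℱ.IsRightContinuous]
    [SecondCountableTopology E] [CompleteSpace E] [SigmaFinite ν] (hν : IsLevyMeasure ν)
    (hN : IsPoissonNoise P ℱ N ν) (hsymm : IsSymmetricMeasure ν) (hε : ε ∈ Ioo (0 : ℝ) 1)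
    (hx : IsUniqueGlobalSolution P ℱ f ξ (levyProcess ν N) x)
    (hY : IsUniqueGlobalSolution P ℱ f ξ (smallJumpIntegral ν N ε) Y) {T : ℝ≥0} {κ : ℝ}
    (hpos : 0 < P {ω | ‖(Y ω).segment T‖ ≤ κ}) : 0 < P {ω | ‖(x ω).segment T‖ ≤ κ} := by
  obtain ⟨A, hA, hAY⟩ := exists_regionSigma_ae_eq hY T κ
  -- the horizon exceeds `T` because solutions are only compared strictly before the first jump
  set B : Set (E × ℝ) := {z | ε < ‖z‖} ×ˢ Ioc (0 : ℝ) ((T + 1 : ℝ≥0) : ℝ) with hB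
  have hBm : MeasurableSet B := measurableSet_largeJumps ε (T + 1)
  have hBfin : ν.prod (volume.restrict (Ioi (0 : ℝ))) B ≠ ∞ := by
    rw [hB, Measure.prod_prod]
    refine ENNReal.mul_ne_top (hν.measure_norm_gt_ne_top hε.1)
      (ne_top_of_le_ne_top ?_ (Measure.restrict_apply_le _ _))
    simp
  have hdisj : Disjoint ({z : E | ‖z‖ ≤ ε} ×ˢ (univ : Set ℝ)) B :=
    disjoint_left.2 fun p hp hpB => absurd hpB.1 (not_lt.2 (show ‖p.1‖ ≤ ε from hp.1))
  have hind := (Indep_iff _ _ P).1 (hN.poisson.indep_regionSigma hBm hdisj) A {ω | N ω B = 0} hA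
    ⟨{0}, measurableSet_singleton 0, rfl⟩
  have hsub : (A ∩ {ω | N ω B = 0} : Set Ω) ≤ᵐ[P] {ω | ‖(x ω).segment T‖ ≤ κ} := by
    filter_upwards [hAY, ae_segment_eq_of_void hN hsymm hε.2.le hx hY (lt_add_one T)]
      with ω h1 h2 h3
    have h4 : ‖(Y ω).segment T‖ ≤ κ := h1.mp h3.1
    change ‖(x ω).segment T‖ ≤ κ
    rwa [h2 h3.2]
  refine lt_of_lt_of_le ?_ (measure_mono_ae hsub)
  rw [hind, measure_congr hAY]
  exact ENNReal.mul_pos hpos.ne' (hN.poisson.void_pos hBm hBfin).ne'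

end Comparison

/-! ### Positive probabilities and the resolvent -/

theorem measure_norm_le_pos_of_tendstoInMeasure {Ω H : Type*} [MeasurableSpace Ω] {P : Measure Ω}
    [IsProbabilityMeasure P] [NormedAddCommGroup H] {Y : ℝ → Ω → H} {y : H} {κ : ℝ}
    {l : Filter ℝ} (h : TendstoInMeasure P Y l fun _ => y) (hy : ‖y‖ < κ) :
    ∀ᶠ ε in l, 0 < P {ω | ‖Y ε ω‖ ≤ κ} := by
  rw [tendstoInMeasure_iff_norm] at h
  filter_upwards [(h (κ - ‖y‖) (sub_pos.2 hy)).eventually_lt_const one_pos] with ε hε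
  by_contra h0
  have hcover : (univ : Set Ω) ⊆ {ω | κ - ‖y‖ ≤ ‖Y ε ω - y‖} ∪ {ω | ‖Y ε ω‖ ≤ κ} := by
    intro ω _
    by_contra hω
    simp only [mem_union, mem_ofPred_eq, not_or, not_le] at hω
    linarith [norm_le_norm_add_norm_sub' (Y ε ω) y]
  have := (measure_mono hcover).trans (measure_union_le (μ := P) _ _)
  rw [measure_univ, le_antisymm (not_lt.1 h0) zero_le, add_zero] at this
  exact absurd this (not_le.2 hε)

/-- The resolvent integrand need not be measurable in time, so positivity of each probability is
not enough; the bound at time `T + 1` is uniform over `(T, T + 1]` because `e^{rt} ‖x_t‖` is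
nondecreasing. -/
theorem resolvent_pos {Ω E : Type*} [MeasurableSpace Ω] [NormedAddCommGroup E] [NormedSpace ℝ E]
    {r : ℝ} (hr : 0 < r) {P : Measure Ω} {x : Ω → Trajectory E r} {κ : ℝ} (hκ : 0 ≤ κ) {T : ℝ}
    (hT : 0 ≤ T) (hpos : 0 < P {ω | ‖(x ω).segment (T + 1)‖ ≤ Real.exp (-r) * κ})
    {U : Set (PhaseSpace E r)} (hU : Metric.closedBall 0 κ ⊆ U) {lam : ℝ} (hlam : 0 < lam) :
    0 < resolvent P (fun t ω => (x ω).segment t) lam U := by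
  refine ENNReal.mul_pos (ENNReal.ofReal_pos.2 hlam).ne' (ne_of_gt ?_)
  set c := ENNReal.ofReal (Real.exp (-(lam * (T + 1)))) *
    P {ω | ‖(x ω).segment (T + 1)‖ ≤ Real.exp (-r) * κ} with hc
  have hc0 : 0 < c := ENNReal.mul_pos (ENNReal.ofReal_pos.2 (Real.exp_pos _)).ne' hpos.ne'
  calc 0 < c := hc0
    _ = ∫⁻ _ in Ioc T (T + 1), c := by simp
    _ ≤ ∫⁻ t in Ioc T (T + 1), ENNReal.ofReal (Real.exp (-(lam * t))) *
          P {ω | (x ω).segment t ∈ U} := by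
        refine setLIntegral_mono' measurableSet_Ioc fun t ht => ?_
        refine mul_le_mul' (ENNReal.ofReal_le_ofReal (Real.exp_le_exp.2 ?_))
          (measure_mono fun ω hω => hU (mem_closedBall_zero_iff.2 ?_))
        · exact neg_le_neg (mul_le_mul_of_nonneg_left ht.2 hlam.le)
        · refine (x ω).norm_segment_le_of_le ht.2 (le_trans hω ?_)
          refine mul_le_mul_of_nonneg_right (Real.exp_le_exp.2 (neg_le_neg ?_)) hκ
          exact mul_le_of_le_one_right hr.le (by linarith [ht.1])
    _ ≤ _ := lintegral_mono_set fun t ht => lt_of_le_of_lt hT ht.1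

end DelaySDE

end

theorem theorem2p1 {Ω : Type*} [mΩ : MeasurableSpace Ω] (P : Measure Ω) [IsProbabilityMeasure P]
    -- a filtration satisfying the usual conditions
    (ℱ : Filtration ℝ≥0 mΩ) [ℱ.IsRightContinuous]
    (hℱ : ∀ A : Set Ω, P A = 0 → MeasurableSet[ℱ 0] A)
    (n : ℕ) (r : ℝ) (hr : 0 < r)
    -- the driving noise
    (ν : Measure (EuclideanSpace ℝ (Fin n))) [SigmaFinite ν] (hν : DelaySDE.IsLevyMeasure ν)
    (N : Ω → Measure (EuclideanSpace ℝ (Fin n) × ℝ)) (hN : DelaySDE.IsPoissonNoise P ℱ N ν)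
    -- the coefficient
    (f : DelaySDE.PhaseSpace (EuclideanSpace ℝ (Fin n)) r → EuclideanSpace ℝ (Fin n))
    (hf : Measurable f)
    -- symmetry of the Lévy measure
    (hsymm : DelaySDE.IsSymmetricMeasure ν)
    -- unique global solutions of the three equations
    (x : DelaySDE.PhaseSpace (EuclideanSpace ℝ (Fin n)) r → Ω →
      DelaySDE.Trajectory (EuclideanSpace ℝ (Fin n)) r)
    (hx : ∀ ξ, DelaySDE.IsUniqueGlobalSolution P ℱ f ξ (DelaySDE.levyProcess ν N) (x ξ))
    (Xε : ℝ → DelaySDE.PhaseSpace (EuclideanSpace ℝ (Fin n)) r → Ω →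
      DelaySDE.Trajectory (EuclideanSpace ℝ (Fin n)) r)
    (hXε : ∀ ε ∈ Ioo (0 : ℝ) 1, ∀ ξ, DelaySDE.IsUniqueGlobalSolution P ℱ f ξ
      (DelaySDE.smallJumpIntegral ν N ε) (Xε ε ξ))
    (X : DelaySDE.PhaseSpace (EuclideanSpace ℝ (Fin n)) r →
      DelaySDE.Trajectory (EuclideanSpace ℝ (Fin n)) r)
    (hX : ∀ ξ, DelaySDE.IsUniqueDeterministicSolution f ξ (X ξ))
    -- decay of the deterministic solutions
    (hdecay : ∀ ξ, Tendsto (fun t : ℝ => ‖(X ξ).segment t‖) atTop (𝓝 0))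
    -- convergence in probability as the truncation level tends to zero
    (hconv : ∀ t : ℝ, 0 < t → ∀ ξ, TendstoInMeasure P (fun ε ω => (Xε ε ξ ω).segment t)
      (𝓝[>] (0 : ℝ)) (fun _ => (X ξ).segment t)) :
    DelaySDE.IsWeaklyIrreducibleTo P (fun ξ t ω => (x ξ ω).segment t) 0 ∧
      ∀ ξ, ∀ κ : ℝ, 0 < κ → ∃ T₀ : ℝ, ∀ T : ℝ, T₀ < T →
        0 < P {ω | ‖(x ξ ω).segment T‖ ≤ κ} := by
  have key : ∀ ξ, ∀ κ : ℝ, 0 < κ → ∃ T₀ : ℝ, 0 ≤ T₀ ∧ ∀ T : ℝ, T₀ < T →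
      0 < P {ω | ‖(x ξ ω).segment T‖ ≤ κ} := by
    intro ξ κ hκ
    obtain ⟨T₀, hT₀⟩ := eventually_atTop.1 ((hdecay ξ).eventually_lt_const hκ)
    refine ⟨max T₀ 0, le_max_right _ _, fun T hT => ?_⟩
    have hT0 : 0 < T := lt_of_le_of_lt (le_max_right _ _) hT
    obtain ⟨ε, hpos, hε⟩ := ((DelaySDE.measure_norm_le_pos_of_tendstoInMeasure (hconv T hT0 ξ)
      (hT₀ T (lt_of_le_of_lt (le_max_left _ _) hT).le)).and
      (Ioo_mem_nhdsGT (zero_lt_one (α := ℝ)))).exists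
    exact DelaySDE.measure_norm_segment_le_pos (T := ⟨T, hT0.le⟩) hν hN hsymm hε (hx ξ)
      (hXε ε hε ξ) hpos
  refine ⟨fun ξ U hU lam hlam => ?_, fun ξ κ hκ => ?_⟩
  · obtain ⟨κ, hκ, hball⟩ := Metric.nhds_basis_closedBall.mem_iff.1 hU
    obtain ⟨T₀, hT₀, h⟩ := key ξ (Real.exp (-r) * κ) (by positivity)
    exact DelaySDE.resolvent_pos hr hκ.le hT₀ (h (T₀ + 1) (lt_add_one T₀)) hball hlam
  · obtain ⟨T₀, -, h⟩ := key ξ κ hκ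
    exact ⟨T₀, h⟩
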